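/- For $\epsilon,\epsilon'\in\mathbb{R}$, $\zeta\in\mathbb{C}$ and $\tau\in\mathbb{C}$ with $\operatorname{Im}\tau>0$ put $$\theta\left[\begin{smallmatrix}\epsilon\\ \epsilon'\end{smallmatrix}\right](\zeta,\tau)=\sum_{n\in\mathbb{Z}}\exp\left(2\pi i\left[\tfrac12\left(n+\tfrac{\epsilon}{2}\right)^2\tau+\left(n+\tfrac{\epsilon}{2}\right)\left(\zeta+\tfrac{\epsilon'}{2}\right)\right]\right),$$ and write $\theta[\epsilon;\epsilon']$ for its value at $\zeta=0$, $\theta'[\epsilon;\epsilon']$ for its $\zeta$-derivative at $\zeta=0$, and $\zeta_3=e^{2\pi i/3}$. **Theorem.** For every $\tau$ in the upper half plane the theta constants $\theta[0;0]$, $\theta[1;0]$, $\theta[0;1]$, $\theta[\frac13;\frac13]$, $\theta[\frac23;\frac53]$, $\theta[\frac13;1]$, $\theta[\frac23;1]$, $\theta[\frac13;\frac53]$, $\theta[\frac23;\frac13]$, $\theta[1;\frac13]$, $\theta[1;\frac23]$ are all nonzero (so that every denominator below is nonzero), and $$\begin{aligned} \frac{\theta'[\frac13;\frac13]}{\theta[\frac13;\frac13]}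 &=\frac13\,\frac{\theta'[1;1]\,\theta[\frac13;\frac13]^3}{\theta[0;1]\,\theta[\frac23;\frac53]^3} -\zeta_3\,\frac{\theta'[1;1]\,\theta[0;1]\,\theta[\frac13;\frac43]\,\theta[\frac23;\frac23]}{\theta[0;0]\,\theta[1;0]\,\theta[\frac13;\frac13]\,\theta[\frac23;\frac53]}\\ &=-\frac{\pi}{3}\,\theta[0;0]\,\theta[1;0]\,\frac{\theta[\frac13;\frac13]^3}{\theta[\frac23;\frac53]^3} +\pi\zeta_3\,\theta[0;1]^2\,\frac{\theta[\frac13;\frac43]\,\theta[\frac23;\frac23]}{\theta[\frac13;\frac13]\,\theta[\frac23;\frac53]}. \end{aligned}$$ Likewise $$\begin{aligned} \frac{\theta'[\frac13;1]}{\theta[\frac13;1]} &=-\frac13\,\frac{\theta'[1;1]\,\theta[\frac13;1]^3}{\theta[0;1]\,\theta[\frac23;1]^3} +\frac{\theta'[1;1]\,\theta[0;1]\,\theta[\frac13;0]\,\theta[\frac23;0]}{\theta[0;0]\,\theta[1;0]\,\theta[\frac13;1]\,\theta[\frac23;1]}\\ &=\frac{\pi}{3}\,\theta[0;0]\,\theta[1;0]\,\frac{\theta[\frac13;1]^3}{\theta[\frac23;1]^3}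 -\pi\,\theta[0;1]^2\,\frac{\theta[\frac13;0]\,\theta[\frac23;0]}{\theta[\frac13;1]\,\theta[\frac23;1]}, \end{aligned}$$ $$\begin{aligned} \frac{\theta'[\frac13;\frac53]}{\theta[\frac13;\frac53]} &=\frac13\,\frac{\theta'[1;1]\,\theta[\frac13;\frac53]^3}{\theta[0;1]\,\theta[\frac23;\frac13]^3} +\zeta_3^2\,\frac{\theta'[1;1]\,\theta[0;1]\,\theta[\frac13;\frac23]\,\theta[\frac23;\frac43]}{\theta[0;0]\,\theta[1;0]\,\theta[\frac13;\frac53]\,\theta[\frac23;\frac13]}\\ &=-\frac{\pi}{3}\,\theta[0;0]\,\theta[1;0]\,\frac{\theta[\frac13;\frac53]^3}{\theta[\frac23;\frac13]^3} -\pi\zeta_3^2\,\theta[0;1]^2\,\frac{\theta[\frac13;\frac23]\,\theta[\frac23;\frac43]}{\theta[\frac13;\frac53]\,\theta[\frac23;\frac13]}, \end{aligned}$$ $$\begin{aligned} \frac{\theta'[1;\frac13]}{\theta[1;\frac13]} &=-\frac13\,\frac{\theta'[1;1]\,\theta[1;\frac13]^3}{\theta[1;0]\,\theta[1;\frac23]^3}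 +\frac{\theta'[1;1]\,\theta[1;0]\,\theta[0;\frac13]\,\theta[0;\frac23]}{\theta[0;0]\,\theta[0;1]\,\theta[1;\frac13]\,\theta[1;\frac23]}\\ &=\frac{\pi}{3}\,\theta[0;0]\,\theta[0;1]\,\frac{\theta[1;\frac13]^3}{\theta[1;\frac23]^3} -\pi\,\theta[1;0]^2\,\frac{\theta[0;\frac13]\,\theta[0;\frac23]}{\theta[1;\frac13]\,\theta[1;\frac23]}. \end{aligned}$$ -/

import Mathlib

open Complex in
/-- The theta function with real characteristic `[ε; ε']`:
`∑_{n ∈ ℤ} exp (2πi (½ (n + ε/2)² τ + (n + ε/2) (ζ + ε'/2)))`. -/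
noncomputable def thetaChar (ε ε' : ℝ) (ζ τ : ℂ) : ℂ :=
  ∑' n : ℤ, exp (2 * (Real.pi : ℂ) * I *
    (1 / 2 * ((n : ℂ) + (ε : ℂ) / 2) ^ 2 * τ +
      ((n : ℂ) + (ε : ℂ) / 2) * (ζ + (ε' : ℂ) / 2)))

/-- The theta constant `θ[ε; ε'] = θ[ε; ε'](0, τ)`. -/
noncomputable def thetaConst (ε ε' : ℝ) (τ : ℂ) : ℂ :=
  thetaChar ε ε' 0 τ

/-- The theta derivative `θ'[ε; ε']`, the derivative of `ζ ↦ θ[ε; ε'](ζ, τ)` at `ζ = 0`. -/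
noncomputable def thetaDeriv (ε ε' : ℝ) (τ : ℂ) : ℂ :=
  deriv (fun ζ : ℂ => thetaChar ε ε' ζ τ) 0

open Complex in
/-- The primitive root of unity `ζ_k = exp (2πi / k)`. -/
noncomputable def zetaRoot (k : ℕ) : ℂ :=
  exp (2 * (Real.pi : ℂ) * I / (k : ℂ))

/-! The addition formula `thetaChar_mul` turns products at modulus `τ` into sums of products at
`2τ`, and the whole proof rests on it. Nonvanishing: a zero of a theta constant at `τ` propagates to
`2 ^ k * τ` for all `k`, whereas the series divided by its leading exponential stays away from zero
as `k → ∞`. Jacobi's formula `thetaDeriv_one_one` has the same mechanism: `jacobiRatio` is invariant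
under `τ ↦ 2τ` and its limit is `-π`. For the logarithmic derivatives put `a = θ[1+δ; 1+δ']` and `d
= θ[δ; 1+δ']`. The addition formula writes `a(s)²`, `d(s)²` and the products of the functions of
doubled characteristic with `θ[0;1]` and `θ[1;1]` through the same two functions of `2s`.
Eliminating these gives two three-term relations. When three times the characteristic is trivial,
the doubled functions are constant multiples of `d(-s)` and `a(-s)`, so the derivatives of the
relations at `s = 0` form a linear system for `a'`, `d'`, solved in `log_deriv_of_duplication`.
`thetaConst_duplication` brings the solution to the stated shape, and Jacobi's formula gives the
second form. -/

open Filter Topology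

/-! ### Theta series with real characteristics: convergence, derivative, periodicity. -/

/-- The `n`-th term of the series defining `thetaChar`. -/
noncomputable def thetaTerm (ε ε' : ℝ) (ζ τ : ℂ) (n : ℤ) : ℂ :=
  Complex.exp (2 * (Real.pi : ℂ) * Complex.I *
    (1 / 2 * ((n : ℂ) + (ε : ℂ) / 2) ^ 2 * τ +
      ((n : ℂ) + (ε : ℂ) / 2) * (ζ + (ε' : ℂ) / 2)))

/-- The phase `exp (πix)`. -/
noncomputable def phase (x : ℝ) : ℂ := Complex.exp ((Real.pi : ℂ) * Complex.I * (x : ℂ))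

theorem phase_add (x y : ℝ) : phase (x + y) = phase x * phase y := by
  rw [phase, phase, phase, ← Complex.exp_add]
  congr 1
  push_cast
  ring

theorem phase_ne_zero (x : ℝ) : phase x ≠ 0 := Complex.exp_ne_zero _

theorem phase_zero : phase 0 = 1 := by simp [phase]

theorem phase_one : phase 1 = -1 := by simp [phase, Complex.exp_pi_mul_I]

theorem phase_two : phase 2 = 1 := by
  rw [show (2 : ℝ) = 1 + 1 by norm_num, phase_add, phase_one]
  norm_num

theorem thetaChar_eq_tsum (ε ε' : ℝ) (ζ τ : ℂ) :
    thetaChar ε ε' ζ τ = ∑' n : ℤ, thetaTerm ε ε' ζ τ n := rfl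

/-- Expanding the square turns the characteristic into a shift of the argument by `(ε' + ετ)/2`, so
convergence and differentiability come from `jacobiTheta₂`. -/
theorem thetaTerm_eq (ε ε' : ℝ) (ζ τ : ℂ) (n : ℤ) :
    thetaTerm ε ε' ζ τ n =
      Complex.exp (Real.pi * Complex.I * (ε ^ 2 / 4 * τ + ε * (ζ + ε' / 2))) *
        jacobiTheta₂_term n (ζ + ε' / 2 + ε / 2 * τ) τ := by
  rw [thetaTerm, jacobiTheta₂_term, ← Complex.exp_add]
  congr 1
  ring

theorem thetaChar_eq_jacobiTheta₂ (ε ε' : ℝ) (ζ τ : ℂ) :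
    thetaChar ε ε' ζ τ =
      Complex.exp (Real.pi * Complex.I * (ε ^ 2 / 4 * τ + ε * (ζ + ε' / 2))) *
        jacobiTheta₂ (ζ + ε' / 2 + ε / 2 * τ) τ := by
  rw [thetaChar_eq_tsum, jacobiTheta₂, ← tsum_mul_left]
  exact tsum_congr fun n => thetaTerm_eq ε ε' ζ τ n

theorem summable_thetaTerm (ε ε' : ℝ) (ζ : ℂ) {τ : ℂ} (hτ : 0 < τ.im) :
    Summable (thetaTerm ε ε' ζ τ) := by
  have h := ((summable_jacobiTheta₂_term_iff (ζ + ε' / 2 + ε / 2 * τ) τ).2 hτ).mul_left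
    (Complex.exp (Real.pi * Complex.I * (ε ^ 2 / 4 * τ + ε * (ζ + ε' / 2))))
  exact h.congr fun n => (thetaTerm_eq ε ε' ζ τ n).symm

theorem hasDerivAt_thetaChar (ε ε' : ℝ) (ζ : ℂ) {τ : ℂ} (hτ : 0 < τ.im) :
    HasDerivAt (fun z => thetaChar ε ε' z τ)
      (∑' n : ℤ, 2 * Real.pi * Complex.I * (n + ε / 2) * thetaTerm ε ε' ζ τ n) ζ := by
  have hJ := hasDerivAt_jacobiTheta₂_fst (ζ + ε' / 2 + ε / 2 * τ) hτ
  have hlin : HasDerivAt (fun z : ℂ => z + ε' / 2 + ε / 2 * τ) 1 ζ :=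
    ((hasDerivAt_id ζ).add_const _).add_const _
  have hexp : HasDerivAt
      (fun z : ℂ => Complex.exp (Real.pi * Complex.I * (ε ^ 2 / 4 * τ + ε * (z + ε' / 2))))
      (Complex.exp (Real.pi * Complex.I * (ε ^ 2 / 4 * τ + ε * (ζ + ε' / 2))) *
        (Real.pi * Complex.I * (ε * 1))) ζ :=
    (((((hasDerivAt_id ζ).add_const _).const_mul _).const_add _).const_mul _).cexp
  have h := hexp.mul (hJ.comp ζ hlin)
  have hfun : (fun z => thetaChar ε ε' z τ) =
      (fun z : ℂ => Complex.exp (Real.pi * Complex.I * (ε ^ 2 / 4 * τ + ε * (z + ε' / 2)))) *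
        ((fun w => jacobiTheta₂ w τ) ∘ fun z : ℂ => z + ε' / 2 + ε / 2 * τ) := by
    funext z
    exact thetaChar_eq_jacobiTheta₂ ε ε' z τ
  rw [hfun]
  refine h.congr_deriv ?_
  have h0 := hasSum_jacobiTheta₂_term (ζ + ε' / 2 + ε / 2 * τ) hτ
  have h1 := hasSum_jacobiTheta₂'_term (ζ + ε' / 2 + ε / 2 * τ) hτ
  set c := Complex.exp (Real.pi * Complex.I * (ε ^ 2 / 4 * τ + ε * (ζ + ε' / 2))) with hc
  have h2 := (h0.mul_left (c * (Real.pi * Complex.I * (ε * 1)))).add (h1.mul_left c)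
  simp only [Function.comp_apply, mul_one] at *
  rw [← h2.tsum_eq]
  refine tsum_congr fun n => ?_
  rw [thetaTerm_eq, ← hc, jacobiTheta₂'_term]
  ring

theorem differentiableAt_thetaChar (ε ε' : ℝ) (ζ : ℂ) {τ : ℂ} (hτ : 0 < τ.im) :
    DifferentiableAt ℂ (fun z => thetaChar ε ε' z τ) ζ :=
  (hasDerivAt_thetaChar ε ε' ζ hτ).differentiableAt

theorem hasDerivAt_thetaChar_zero (ε ε' : ℝ) {τ : ℂ} (hτ : 0 < τ.im) :
    HasDerivAt (fun z => thetaChar ε ε' z τ) (thetaDeriv ε ε' τ) 0 :=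
  (differentiableAt_thetaChar ε ε' 0 hτ).hasDerivAt

theorem thetaChar_add_two_left (ε ε' : ℝ) (ζ τ : ℂ) :
    thetaChar (ε + 2) ε' ζ τ = thetaChar ε ε' ζ τ := by
  rw [thetaChar_eq_tsum, thetaChar_eq_tsum, ← (Equiv.subRight (1 : ℤ)).tsum_eq]
  refine tsum_congr fun n => ?_
  simp only [thetaTerm, Equiv.subRight_apply]
  congr 1
  push_cast
  ring

theorem thetaChar_add_two_right (ε ε' : ℝ) (ζ τ : ℂ) :
    thetaChar ε (ε' + 2) ζ τ = phase ε * thetaChar ε ε' ζ τ := by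
  rw [thetaChar_eq_tsum, thetaChar_eq_tsum, ← tsum_mul_left]
  refine tsum_congr fun n => ?_
  rw [thetaTerm, thetaTerm, phase, ← Complex.exp_add, Complex.exp_eq_exp_iff_exists_int]
  refine ⟨n, ?_⟩
  push_cast
  ring

theorem thetaChar_neg (ε ε' : ℝ) (ζ τ : ℂ) :
    thetaChar (-ε) (-ε') (-ζ) τ = thetaChar ε ε' ζ τ := by
  rw [thetaChar_eq_tsum, thetaChar_eq_tsum, ← (Equiv.neg ℤ).tsum_eq]
  refine tsum_congr fun n => ?_
  simp only [thetaTerm, Equiv.neg_apply]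
  congr 1
  push_cast
  ring

/-! ### The addition formula. -/

/-- The partition of `ℤ × ℤ` into pairs with even sum and pairs with odd sum. -/
noncomputable def sumDiffEquiv : (ℤ × ℤ) ⊕ (ℤ × ℤ) ≃ ℤ × ℤ :=
  Equiv.ofBijective
    (Sum.elim (fun p => (p.1 + p.2, p.1 - p.2)) (fun p => (p.1 + p.2 + 1, p.1 - p.2))) <| by
    constructor
    · rintro (⟨a, b⟩ | ⟨a, b⟩) (⟨c, d⟩ | ⟨c, d⟩) h <;>
        simp only [Sum.elim_inl, Sum.elim_inr, Prod.mk.injEq, Sum.inl.injEq, Sum.inr.injEq,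
          reduceCtorEq] at h ⊢ <;> omega
    · rintro ⟨m, n⟩
      rcases Int.even_or_odd' (m + n) with ⟨k, h | h⟩
      · exact ⟨Sum.inl (k, m - k), by simp only [Sum.elim_inl, Prod.mk.injEq]; omega⟩
      · exact ⟨Sum.inr (k, m - k - 1), by simp only [Sum.elim_inr, Prod.mk.injEq]; omega⟩

theorem sumDiffEquiv_inl (p : ℤ × ℤ) :
    sumDiffEquiv (Sum.inl p) = (p.1 + p.2, p.1 - p.2) := rfl

theorem sumDiffEquiv_inr (p : ℤ × ℤ) :
    sumDiffEquiv (Sum.inr p) = (p.1 + p.2 + 1, p.1 - p.2) := rfl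

/-- The addition formula: a product of two theta functions of modulus `τ` is a sum of two products
of theta functions of modulus `2τ`. -/
theorem thetaChar_mul (a b a' b' : ℝ) (u v : ℂ) {τ : ℂ} (hτ : 0 < τ.im) :
    thetaChar a b u τ * thetaChar a' b' v τ =
      thetaChar ((a + a') / 2) (b + b') (u + v) (2 * τ) *
          thetaChar ((a - a') / 2) (b - b') (u - v) (2 * τ) +
        thetaChar ((a + a') / 2 + 1) (b + b') (u + v) (2 * τ) *
          thetaChar ((a - a') / 2 + 1) (b - b') (u - v) (2 * τ) := by
  have hτ2 : 0 < (2 * τ).im := by simpa using hτ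
  have hs (ε ε' : ℝ) (ζ : ℂ) {σ : ℂ} (h : 0 < σ.im) := (summable_thetaTerm ε ε' ζ h).norm
  simp only [thetaChar_eq_tsum]
  rw [tsum_mul_tsum_of_summable_norm (hs a b u hτ) (hs a' b' v hτ),
    tsum_mul_tsum_of_summable_norm (hs _ _ _ hτ2) (hs _ _ _ hτ2),
    tsum_mul_tsum_of_summable_norm (hs _ _ _ hτ2) (hs _ _ _ hτ2), ← sumDiffEquiv.tsum_eq]
  have hsum := summable_mul_of_summable_norm (hs a b u hτ) (hs a' b' v hτ)
  have hsum' : Summable fun c => thetaTerm a b u τ (sumDiffEquiv c).1 *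
      thetaTerm a' b' v τ (sumDiffEquiv c).2 := (sumDiffEquiv.summable_iff).2 hsum
  rw [Summable.tsum_sum (hsum'.comp_injective Sum.inl_injective)
    (hsum'.comp_injective Sum.inr_injective)]
  -- With `m = p + q`, `n = p - q` one has `m² + n² = 2(p² + q²)`, which doubles the modulus; the
  -- odd class shifts `p` and `q` by `1/2`, hence the `+ 1` in the upper characteristics.
  congr 1
  · refine tsum_congr fun p => ?_
    simp only [sumDiffEquiv_inl, thetaTerm, ← Complex.exp_add]
    congr 1
    push_cast
    ring
  · refine tsum_congr fun p => ?_
    simp only [sumDiffEquiv_inr, thetaTerm, ← Complex.exp_add]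
    congr 1
    push_cast
    ring

/-! ### Limits of theta series along `2 ^ k * τ`. -/

theorem summable_one_add_abs_mul_exp {r : ℝ} (hr : 0 < r) :
    Summable fun n : ℤ => (1 + |(n : ℝ)|) * Real.exp (-(r * |(n : ℝ)|)) := by
  have h1 : Summable fun n : ℕ => (1 + (n : ℝ)) * Real.exp (-(r * n)) := by
    have h (k : ℕ) := summable_pow_mul_geometric_of_norm_lt_one k
      (r := Real.exp (-r)) (by simpa using hr)
    refine ((h 0).add (h 1)).congr fun n => ?_
    rw [← Real.exp_nat_mul, show (n : ℝ) * -r = -(r * n) by ring]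
    ring
  refine Summable.of_nat_of_neg ?_ ?_ <;> simpa using h1

/-- Dominated convergence: the bound at `k = 0` dominates all later ones, and each term outside `S`
tends to zero because its index is nonzero. -/
theorem tendsto_tsum_sub_sum {f : ℕ → ℤ → ℂ} {S : Finset ℤ} {C r : ℝ} (hr : 0 < r)
    (h0 : (0 : ℤ) ∈ S)
    (hf : ∀ k, ∀ n ∉ S, ‖f k n‖ ≤ C * ((1 + |(n : ℝ)|) * Real.exp (-(r * 2 ^ k * |(n : ℝ)|)))) :
    Tendsto (fun k => ∑' n, f k n - ∑ n ∈ S, f k n) atTop (𝓝 0) := by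
  classical
  have hC : 0 ≤ C := by
    obtain ⟨m, hm⟩ := Infinite.exists_notMem_finset S
    have h := (norm_nonneg _).trans (hf 0 m hm)
    exact nonneg_of_mul_nonneg_left h (by positivity)
  have hbound (k : ℕ) (n : ℤ) : ‖if n ∈ S then 0 else f k n‖ ≤
      C * ((1 + |(n : ℝ)|) * Real.exp (-(r * |(n : ℝ)|))) := by
    split_ifs with hn
    · rw [norm_zero]
      positivity
    · refine (hf k n hn).trans ?_
      gcongr
      have : (1 : ℝ) ≤ 2 ^ k := one_le_pow₀ (by norm_num)
      nlinarith
  have hs := (summable_one_add_abs_mul_exp hr).mul_left C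
  have hlim := tendsto_tsum_of_dominated_convergence (𝓕 := atTop)
    (f := fun k n => if n ∈ S then 0 else f k n) (g := fun _ => 0) hs
    (fun n => ?_) (Eventually.of_forall hbound)
  · rw [tsum_zero] at hlim
    refine hlim.congr fun k => ?_
    have h1 : HasSum (fun n => if n ∈ S then 0 else f k n) _ :=
      (Summable.of_norm_bounded hs (hbound k)).hasSum
    have h2 : HasSum (fun n => if n ∈ S then f k n else 0)
        (∑ n ∈ S, if n ∈ S then f k n else 0) :=
      hasSum_sum_of_ne_finset_zero fun n hn => if_neg hn
    have h3 := (h1.add h2).tsum_eq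
    rw [Finset.sum_congr rfl fun n hn => if_pos hn] at h3
    rw [eq_sub_iff_add_eq, ← h3]
    refine tsum_congr fun n => ?_
    split_ifs <;> simp
  · by_cases hn : n ∈ S
    · simp [hn]
    · simp only [hn, if_false]
      have hn0 : n ≠ 0 := fun h => hn (h ▸ h0)
      have hn1 : 0 < r * |(n : ℝ)| := mul_pos hr (abs_pos.2 (Int.cast_ne_zero.2 hn0))
      refine squeeze_zero_norm (fun k => hf k n hn) ?_
      have h2 : Tendsto (fun k : ℕ => (r * |(n : ℝ)|) * (2 : ℝ) ^ k) atTop atTop :=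
        (tendsto_pow_atTop_atTop_of_one_lt one_lt_two).const_mul_atTop hn1
      have h3 := ((Real.tendsto_exp_neg_atTop_nhds_zero.comp h2).const_mul
        (1 + |(n : ℝ)|)).const_mul C
      rw [mul_zero, mul_zero] at h3
      refine h3.congr fun k => ?_
      simp only [Function.comp_apply]
      ring_nf

/-- The `n`-th term of a theta constant divided by `exp (πiε²τ/4)`. -/
noncomputable def reducedTerm (ε ε' : ℝ) (τ : ℂ) (n : ℤ) : ℂ :=
  Complex.exp (Real.pi * Complex.I * (((n ^ 2 + n * ε : ℝ) : ℂ) * τ)) *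
    phase ((n + ε / 2) * ε')

/-- The leading factor `exp (πiε²τ/4)` of a theta constant. -/
noncomputable def leadingFactor (ε : ℝ) (τ : ℂ) : ℂ :=
  Complex.exp (Real.pi * Complex.I * (ε ^ 2 / 4 * τ))

theorem leadingFactor_ne_zero (ε : ℝ) (τ : ℂ) : leadingFactor ε τ ≠ 0 := Complex.exp_ne_zero _

theorem thetaTerm_zero_eq (ε ε' : ℝ) (τ : ℂ) (n : ℤ) :
    thetaTerm ε ε' 0 τ n = leadingFactor ε τ * reducedTerm ε ε' τ n := by
  rw [thetaTerm, leadingFactor, reducedTerm, phase, ← Complex.exp_add, ← Complex.exp_add]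
  congr 1
  push_cast
  ring

theorem norm_phase (x : ℝ) : ‖phase x‖ = 1 := by
  rw [phase, show (Real.pi : ℂ) * Complex.I * (x : ℂ) = ((Real.pi * x : ℝ) : ℂ) * Complex.I by
    push_cast; ring]
  exact Complex.norm_exp_ofReal_mul_I _

theorem norm_reducedTerm (ε ε' : ℝ) (τ : ℂ) (n : ℤ) :
    ‖reducedTerm ε ε' τ n‖ = Real.exp (-(Real.pi * (n ^ 2 + n * ε) * τ.im)) := by
  rw [reducedTerm, norm_mul, norm_phase, mul_one, Complex.norm_exp,
    show (Real.pi : ℂ) * Complex.I * (((n ^ 2 + n * ε : ℝ) : ℂ) * τ) =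
      ((Real.pi * (n ^ 2 + n * ε) : ℝ) : ℂ) * (Complex.I * τ) by push_cast; ring,
    Complex.re_ofReal_mul, Complex.I_mul_re, mul_neg]

theorem im_two_pow_mul (k : ℕ) (τ : ℂ) : (2 ^ k * τ).im = 2 ^ k * τ.im := by
  rw [show (2 : ℂ) ^ k = ((2 ^ k : ℝ) : ℂ) by push_cast; rfl, Complex.im_ofReal_mul]

theorem tendsto_tsum_reducedTerm {τ : ℂ} (hτ : 0 < τ.im) (ε : ℝ) (ε' : ℕ → ℝ) {S : Finset ℤ}
    {δ C : ℝ} (hδ : 0 < δ) (h0 : (0 : ℤ) ∈ S)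
    (hS : ∀ n ∉ S, δ * |(n : ℝ)| ≤ n ^ 2 + n * ε) (c : ℤ → ℂ)
    (hc : ∀ n, ‖c n‖ ≤ C * (1 + |(n : ℝ)|)) :
    Tendsto (fun k => ∑' n, c n * reducedTerm ε (ε' k) (2 ^ k * τ) n -
      ∑ n ∈ S, c n * reducedTerm ε (ε' k) (2 ^ k * τ) n) atTop (𝓝 0) := by
  refine tendsto_tsum_sub_sum (r := Real.pi * τ.im * δ) (C := C) (by positivity) h0
    fun k n hn => ?_
  rw [norm_mul, norm_reducedTerm, im_two_pow_mul, ← mul_assoc C]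
  refine mul_le_mul (hc n) ?_ (Real.exp_pos _).le ((norm_nonneg _).trans (hc n))
  rw [Real.exp_le_exp, neg_le_neg_iff]
  calc Real.pi * τ.im * δ * 2 ^ k * |(n : ℝ)|
      = (Real.pi * (2 ^ k * τ.im)) * (δ * |(n : ℝ)|) := by ring
    _ ≤ (Real.pi * (2 ^ k * τ.im)) * (n ^ 2 + n * ε) := by gcongr; exact hS n hn
    _ = _ := by ring

theorem thetaConst_eq (ε ε' : ℝ) (τ : ℂ) :
    thetaConst ε ε' τ = leadingFactor ε τ * ∑' n : ℤ, reducedTerm ε ε' τ n := by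
  rw [thetaConst, thetaChar_eq_tsum, ← tsum_mul_left]
  exact tsum_congr (thetaTerm_zero_eq ε ε' τ)

/-- For `|ε| < 1` the exponent `n² + nε` is minimal only at `n = 0`. That term has norm `1` whatever
`ε'` is, so the lower characteristic may vary with `k`, as doubling requires. -/
theorem exists_thetaConst_ne_zero {τ : ℂ} (hτ : 0 < τ.im) {ε : ℝ} (hε : |ε| < 1) (ε' : ℕ → ℝ) :
    ∃ k, thetaConst ε (ε' k) (2 ^ k * τ) ≠ 0 := by
  by_contra! h
  have hlim := tendsto_tsum_reducedTerm hτ ε ε' (S := {0}) (δ := 1 - |ε|) (C := 1)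
    (by linarith) (by simp) (fun n hn => ?_) (fun _ => 1) (fun n => by simp)
  · have h1 : ∀ k, ‖∑' n, 1 * reducedTerm ε (ε' k) (2 ^ k * τ) n -
        ∑ n ∈ {0}, 1 * reducedTerm ε (ε' k) (2 ^ k * τ) n‖ = 1 := by
      intro k
      have h2 := h k
      rw [thetaConst_eq, mul_eq_zero, or_iff_right (leadingFactor_ne_zero _ _)] at h2
      simp only [one_mul]
      rw [h2, Finset.sum_singleton, zero_sub, norm_neg, norm_reducedTerm]
      simp
    have h3 := hlim.norm
    simp only [h1, norm_zero] at h3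
    exact one_ne_zero (tendsto_nhds_unique tendsto_const_nhds h3)
  · have hn0 : n ≠ 0 := by simpa using hn
    have h1 : (1 : ℝ) ≤ |(n : ℝ)| := by exact_mod_cast Int.one_le_abs hn0
    have h2 : -(|(n : ℝ)| * |ε|) ≤ n * ε := by rw [← abs_mul]; exact neg_abs_le _
    have h3 : |(n : ℝ)| ^ 2 = (n : ℝ) ^ 2 := sq_abs _
    nlinarith

/-- For `ε = 1` the minimal exponent is attained twice, at `n = 0` and `n = -1`; both terms survive
in the limit. -/
theorem abs_le_sq_add_self {n : ℤ} (hn : n ∉ ({0, -1} : Finset ℤ)) :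
    (1 : ℝ) * |(n : ℝ)| ≤ n ^ 2 + n * (1 : ℝ) := by
  simp only [Finset.mem_insert, Finset.mem_singleton, not_or] at hn
  have h : |n| ≤ n ^ 2 + n := by
    rcases lt_trichotomy n 0 with h | h | h
    · rw [abs_of_neg h]
      have : n ≤ -2 := by omega
      nlinarith
    · exact absurd h hn.1
    · rw [abs_of_pos h]
      nlinarith
  rw [one_mul, mul_one]
  exact_mod_cast h

theorem tendsto_tsum_reducedTerm_one {τ : ℂ} (hτ : 0 < τ.im) (ε' : ℝ) (c : ℤ → ℂ) {C : ℝ}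
    (hc : ∀ n, ‖c n‖ ≤ C * (1 + |(n : ℝ)|)) :
    Tendsto (fun k : ℕ => ∑' n, c n * reducedTerm 1 ε' (2 ^ k * τ) n) atTop
      (𝓝 (c 0 * phase (ε' / 2) + c (-1) * phase (-(ε' / 2)))) := by
  have h := tendsto_tsum_reducedTerm hτ 1 (fun _ => ε') (S := {0, -1}) one_pos (by simp)
    (fun n hn => abs_le_sq_add_self hn) c hc
  have h2 : ∀ k : ℕ, ∑ n ∈ ({0, -1} : Finset ℤ), c n * reducedTerm 1 ε' (2 ^ k * τ) n =
      c 0 * phase (ε' / 2) + c (-1) * phase (-(ε' / 2)) := by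
    intro k
    rw [Finset.sum_pair (by norm_num)]
    congr 2
    · simp only [reducedTerm]
      norm_num
      congr 1; ring
    · simp only [reducedTerm]
      norm_num
      congr 1; ring
  simp only [h2] at h
  simpa using h.add_const (c 0 * phase (ε' / 2) + c (-1) * phase (-(ε' / 2)))

/-! ### Nonvanishing of theta constants by doubling. -/

theorem im_two_mul_pos {τ : ℂ} (hτ : 0 < τ.im) : 0 < (2 * τ).im := by simpa using hτ

theorem im_two_pow_mul_pos {τ : ℂ} (hτ : 0 < τ.im) (k : ℕ) : 0 < (2 ^ k * τ).im := by
  rw [im_two_pow_mul]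
  positivity

theorem two_pow_succ_mul (k : ℕ) (τ : ℂ) : (2 : ℂ) ^ (k + 1) * τ = 2 * (2 ^ k * τ) := by ring

theorem thetaConst_add_two_left (ε ε' : ℝ) (τ : ℂ) :
    thetaConst (ε + 2) ε' τ = thetaConst ε ε' τ := thetaChar_add_two_left ε ε' 0 τ

theorem thetaConst_add_two_right (ε ε' : ℝ) (τ : ℂ) :
    thetaConst ε (ε' + 2) τ = phase ε * thetaConst ε ε' τ := thetaChar_add_two_right ε ε' 0 τ

theorem thetaConst_neg (ε ε' : ℝ) (τ : ℂ) : thetaConst (-ε) (-ε') τ = thetaConst ε ε' τ := by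
  simpa [thetaConst] using thetaChar_neg ε ε' 0 τ

theorem thetaConst_mul (a b a' b' : ℝ) {τ : ℂ} (hτ : 0 < τ.im) :
    thetaConst a b τ * thetaConst a' b' τ =
      thetaConst ((a + a') / 2) (b + b') (2 * τ) * thetaConst ((a - a') / 2) (b - b') (2 * τ) +
        thetaConst ((a + a') / 2 + 1) (b + b') (2 * τ) *
          thetaConst ((a - a') / 2 + 1) (b - b') (2 * τ) := by
  simpa [thetaConst] using thetaChar_mul a b a' b' 0 0 hτ

theorem thetaConst_one_one (τ : ℂ) : thetaConst 1 1 τ = 0 := by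
  have h1 := thetaConst_neg 1 1 τ
  have h2 := thetaConst_add_two_left (-1) (-1) τ
  have h3 := thetaConst_add_two_right 1 (-1) τ
  norm_num [phase_one] at h2 h3
  have : (2 : ℂ) * thetaConst 1 1 τ = 0 := by
    linear_combination h3 - h2 - h1
  simpa using this

/-- The second summand of the addition formula contains the odd constant `θ[1;1](2τ) = 0`. -/
theorem thetaConst_mul_sub_one (ε ε' : ℝ) {τ : ℂ} (hτ : 0 < τ.im) :
    thetaConst ε ε' τ * thetaConst ε (ε' - 1) τ =
      thetaConst ε (2 * ε' - 1) (2 * τ) * thetaConst 0 1 (2 * τ) := by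
  have h := thetaConst_mul ε ε' ε (ε' - 1) hτ
  rw [show (ε + ε) / 2 = ε by ring, show ε' + (ε' - 1) = 2 * ε' - 1 by ring,
    show (ε - ε) / 2 = 0 by ring, show ε' - (ε' - 1) = 1 by ring, zero_add,
    thetaConst_one_one, mul_zero, add_zero] at h
  exact h

theorem thetaConst_zero_neg_one (τ : ℂ) : thetaConst 0 (-1) τ = thetaConst 0 1 τ := by
  simpa using thetaConst_neg 0 1 τ

theorem thetaConst_zero_zero_mul_zero_one {τ : ℂ} (hτ : 0 < τ.im) :
    thetaConst 0 0 τ * thetaConst 0 1 τ = thetaConst 0 1 (2 * τ) ^ 2 := by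
  have h := thetaConst_mul_sub_one 0 0 hτ
  norm_num [thetaConst_zero_neg_one] at h
  rw [h, sq]

theorem thetaConst_one_zero_sq {τ : ℂ} (hτ : 0 < τ.im) :
    thetaConst 1 0 τ ^ 2 = 2 * (thetaConst 0 0 (2 * τ) * thetaConst 1 0 (2 * τ)) := by
  have h := thetaConst_mul 1 0 1 0 hτ
  have h2 := thetaConst_add_two_left 0 0 (2 * τ)
  norm_num at h h2
  rw [h2] at h
  linear_combination h

theorem thetaConst_zero_one_ne_zero {τ : ℂ} (hτ : 0 < τ.im) : thetaConst 0 1 τ ≠ 0 := by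
  intro h
  have h0 (k : ℕ) : thetaConst 0 1 (2 ^ k * τ) = 0 := by
    induction k with
    | zero => simpa using h
    | succ k ih =>
      have h1 := thetaConst_zero_zero_mul_zero_one (im_two_pow_mul_pos hτ k)
      rw [ih, mul_zero, ← two_pow_succ_mul] at h1
      exact pow_eq_zero_iff two_ne_zero |>.1 h1.symm
  obtain ⟨k, hk⟩ := exists_thetaConst_ne_zero hτ (ε := 0) (by simp) fun _ => 1
  exact hk (h0 k)

theorem thetaConst_double_eq_zero {ε ε' : ℝ} {τ : ℂ} (hτ : 0 < τ.im)
    (h : thetaConst ε ε' τ = 0) : thetaConst ε (2 * ε' - 1) (2 * τ) = 0 := by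
  have h1 := thetaConst_mul_sub_one ε ε' hτ
  rw [h, zero_mul, eq_comm, mul_eq_zero,
    or_iff_left (thetaConst_zero_one_ne_zero (im_two_mul_pos hτ))] at h1
  exact h1

/-- Doubling moves `ε'` to `2ε' - 1`, whose fixed point is `1`; the `k`-th iterate is therefore `2 ^
k * (ε' - 1) + 1`. -/
theorem thetaConst_ne_zero_of_abs_lt_one {ε : ℝ} (hε : |ε| < 1) (ε' : ℝ) {τ : ℂ}
    (hτ : 0 < τ.im) : thetaConst ε ε' τ ≠ 0 := by
  intro h
  have h0 (k : ℕ) : thetaConst ε (2 ^ k * (ε' - 1) + 1) (2 ^ k * τ) = 0 := by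
    induction k with
    | zero => simpa using h
    | succ k ih =>
      have h1 := thetaConst_double_eq_zero (im_two_pow_mul_pos hτ k) ih
      rw [← two_pow_succ_mul] at h1
      rw [← h1]
      congr 1
      ring
  obtain ⟨k, hk⟩ := exists_thetaConst_ne_zero hτ hε _
  exact hk (h0 k)

theorem phase_add_phase_neg (x : ℝ) : phase x + phase (-x) = 2 * (Real.cos (Real.pi * x) : ℂ) := by
  rw [phase, phase, Complex.ofReal_cos, Complex.cos]
  push_cast
  ring_nf

theorem tendsto_thetaConst_one_div {τ : ℂ} (hτ : 0 < τ.im) (ε' : ℝ) :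
    Tendsto (fun k : ℕ => thetaConst 1 ε' (2 ^ k * τ) / leadingFactor 1 (2 ^ k * τ)) atTop
      (𝓝 (2 * (Real.cos (Real.pi * (ε' / 2)) : ℂ))) := by
  have h := tendsto_tsum_reducedTerm_one hτ ε' (fun _ => 1) (C := 1) (fun n => by simp)
  simp only [one_mul, phase_add_phase_neg] at h
  refine h.congr fun k => ?_
  rw [thetaConst_eq, mul_div_cancel_left₀ _ (leadingFactor_ne_zero _ _)]

/-- Here the two leading terms could cancel; their sum is `2 cos(πε'/2)`, hence the cosine
hypothesis. -/
theorem thetaConst_one_ne_zero {ε' : ℝ} (hε' : Real.cos (Real.pi * (ε' / 2)) ≠ 0)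
    (hdouble : ∀ σ : ℂ, 0 < σ.im → thetaConst 1 ε' σ = 0 → thetaConst 1 ε' (2 * σ) = 0)
    {τ : ℂ} (hτ : 0 < τ.im) : thetaConst 1 ε' τ ≠ 0 := by
  intro h
  have h0 (k : ℕ) : thetaConst 1 ε' (2 ^ k * τ) = 0 := by
    induction k with
    | zero => simpa using h
    | succ k ih => rw [two_pow_succ_mul]; exact hdouble _ (im_two_pow_mul_pos hτ k) ih
  have h1 := tendsto_thetaConst_one_div hτ ε'
  simp only [h0, zero_div] at h1
  have h2 := tendsto_nhds_unique h1 tendsto_const_nhds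
  exact hε' (Complex.ofReal_eq_zero.1 ((mul_eq_zero.1 h2).resolve_left two_ne_zero))

theorem thetaConst_one_zero_ne_zero {τ : ℂ} (hτ : 0 < τ.im) : thetaConst 1 0 τ ≠ 0 := by
  refine thetaConst_one_ne_zero (by simp) (fun σ hσ h => ?_) hτ
  have h1 := thetaConst_one_zero_sq hσ
  have h2 := thetaConst_ne_zero_of_abs_lt_one (ε := 0) (by simp) 0 (im_two_mul_pos hσ)
  simpa [h, h2] using h1

theorem thetaConst_one_neg (ε' : ℝ) (τ : ℂ) : thetaConst 1 (-ε') τ = thetaConst 1 ε' τ := by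
  rw [← thetaConst_neg 1 ε' τ, ← thetaConst_add_two_left (-1)]
  norm_num

/-- Doubling sends `1/3` to `-1/3`, and `θ[1; ·]` is even in the lower characteristic, so the zero
persists. -/
theorem thetaConst_one_third_ne_zero {τ : ℂ} (hτ : 0 < τ.im) : thetaConst 1 (1 / 3) τ ≠ 0 := by
  refine thetaConst_one_ne_zero ?_ (fun σ hσ h => ?_) hτ
  · rw [show Real.pi * (1 / 3 / 2) = Real.pi / 6 by ring, Real.cos_pi_div_six]
    positivity
  · have h1 := thetaConst_double_eq_zero hσ h
    rw [show (2 : ℝ) * (1 / 3) - 1 = -(1 / 3) by norm_num, thetaConst_one_neg] at h1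
    exact h1

theorem thetaConst_one_two_thirds_ne_zero {τ : ℂ} (hτ : 0 < τ.im) :
    thetaConst 1 (2 / 3) τ ≠ 0 := by
  intro h
  have h1 := thetaConst_double_eq_zero hτ h
  rw [show (2 : ℝ) * (2 / 3) - 1 = 1 / 3 by norm_num] at h1
  exact thetaConst_one_third_ne_zero (im_two_mul_pos hτ) h1

/-! ### Jacobi's derivative formula. -/

theorem thetaDeriv_eq (ε ε' : ℝ) {τ : ℂ} (hτ : 0 < τ.im) :
    thetaDeriv ε ε' τ = leadingFactor ε τ *
      ∑' n : ℤ, 2 * Real.pi * Complex.I * (n + ε / 2) * reducedTerm ε ε' τ n := by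
  rw [thetaDeriv, (hasDerivAt_thetaChar ε ε' 0 hτ).deriv, ← tsum_mul_left]
  refine tsum_congr fun n => ?_
  rw [thetaTerm_zero_eq]
  ring

/-- Derivative at `0` of `θ[1;1](z,τ) θ[1;0](z,τ) = θ[1;1](2z,2τ) θ[0;1](0,2τ)`; the `2` is the
inner derivative. -/
theorem thetaDeriv_one_one_mul {τ : ℂ} (hτ : 0 < τ.im) :
    thetaDeriv 1 1 τ * thetaConst 1 0 τ =
      2 * (thetaDeriv 1 1 (2 * τ) * thetaConst 0 1 (2 * τ)) := by
  have hτ2 := im_two_mul_pos hτ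
  have h11 := hasDerivAt_thetaChar_zero 1 1 hτ
  have h10 := hasDerivAt_thetaChar_zero 1 0 hτ
  have hlin : HasDerivAt (fun z : ℂ => z + z) (1 + 1) 0 := (hasDerivAt_id _).add (hasDerivAt_id _)
  have h11' := hasDerivAt_thetaChar_zero 1 1 hτ2
  have h1 := h11.mul h10
  have h2 := (h11'.comp_of_eq 0 hlin (by simp)).mul_const (thetaConst 0 1 (2 * τ))
  have hfun : (fun z => thetaChar 1 1 z τ) * (fun z => thetaChar 1 0 z τ) =
      fun z => ((fun z => thetaChar 1 1 z (2 * τ)) ∘ fun z : ℂ => z + z) z *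
        thetaConst 0 1 (2 * τ) := by
    funext z
    have h := thetaChar_mul 1 1 1 0 z z hτ
    have h' := thetaConst_one_one (2 * τ)
    rw [thetaConst] at h'
    norm_num [h'] at h
    exact h
  rw [hfun] at h1
  have h3 := h1.unique h2
  have h' := thetaConst_one_one τ
  simp only [thetaConst] at h' ⊢ h3
  rw [h'] at h3
  linear_combination h3

/-- The ratio of the two sides of Jacobi's derivative formula, up to the constant `-π`. -/
noncomputable def jacobiRatio (τ : ℂ) : ℂ :=
  thetaDeriv 1 1 τ / (thetaConst 0 0 τ * thetaConst 1 0 τ * thetaConst 0 1 τ)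

theorem jacobiRatio_two_mul {τ : ℂ} (hτ : 0 < τ.im) : jacobiRatio (2 * τ) = jacobiRatio τ := by
  have hτ2 := im_two_mul_pos hτ
  have h00 := thetaConst_ne_zero_of_abs_lt_one (ε := 0) (by simp) 0 hτ
  have h01 := thetaConst_zero_one_ne_zero hτ
  have h10 := thetaConst_one_zero_ne_zero hτ
  have h00' := thetaConst_ne_zero_of_abs_lt_one (ε := 0) (by simp) 0 hτ2
  have h01' := thetaConst_zero_one_ne_zero hτ2
  have h10' := thetaConst_one_zero_ne_zero hτ2
  have e1 := thetaDeriv_one_one_mul hτ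
  have e2 := thetaConst_zero_zero_mul_zero_one hτ
  have e3 := thetaConst_one_zero_sq hτ
  rw [jacobiRatio, jacobiRatio, div_eq_div_iff (by positivity) (by positivity)]
  refine mul_left_cancel₀ (mul_ne_zero h10 h01') ?_
  linear_combination
    (-thetaConst 0 0 (2 * τ) * thetaConst 1 0 (2 * τ) * thetaConst 0 1 (2 * τ) ^ 2) * e1 +
      (thetaDeriv 1 1 (2 * τ) * thetaConst 0 1 (2 * τ) * thetaConst 1 0 τ ^ 2) * e2 +
      (thetaDeriv 1 1 (2 * τ) * thetaConst 0 1 (2 * τ) ^ 3) * e3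

theorem tendsto_thetaConst_zero {τ : ℂ} (hτ : 0 < τ.im) (ε' : ℝ) :
    Tendsto (fun k : ℕ => thetaConst 0 ε' (2 ^ k * τ)) atTop (𝓝 1) := by
  have h := tendsto_tsum_reducedTerm hτ 0 (fun _ => ε') (S := {0}) (δ := 1) (C := 1)
    one_pos (by simp) (fun n hn => ?_) (fun _ => 1) (fun n => by simp)
  · have h1 := h.add_const 1
    rw [zero_add] at h1
    refine h1.congr fun k => ?_
    rw [thetaConst_eq]
    simp [reducedTerm, leadingFactor, phase_zero]
  · have hn0 : n ≠ 0 := by simpa using hn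
    have h1 : (1 : ℝ) ≤ |(n : ℝ)| := by exact_mod_cast Int.one_le_abs hn0
    rw [← sq_abs]
    nlinarith

theorem phase_half : phase (1 / 2) = Complex.I := by
  rw [phase, show (Real.pi : ℂ) * Complex.I * ((1 / 2 : ℝ) : ℂ) = Real.pi / 2 * Complex.I by
    push_cast; ring, Complex.exp_pi_div_two_mul_I]

theorem phase_neg_half : phase (-(1 / 2)) = -Complex.I := by
  rw [phase, show (Real.pi : ℂ) * Complex.I * ((-(1 / 2) : ℝ) : ℂ) = -Real.pi / 2 * Complex.I by
    push_cast; ring, Complex.exp_neg_pi_div_two_mul_I]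

theorem tendsto_thetaDeriv_one_one_div {τ : ℂ} (hτ : 0 < τ.im) :
    Tendsto (fun k : ℕ => thetaDeriv 1 1 (2 ^ k * τ) / leadingFactor 1 (2 ^ k * τ)) atTop
      (𝓝 (-2 * Real.pi)) := by
  have h := tendsto_tsum_reducedTerm_one hτ 1
    (fun n => 2 * Real.pi * Complex.I * (n + (1 : ℝ) / 2)) (C := 2 * Real.pi) (fun n => ?_)
  · rw [phase_half, phase_neg_half] at h
    have hc : 2 * Real.pi * Complex.I * (((0 : ℤ) : ℂ) + (1 : ℝ) / 2) * Complex.I +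
        2 * Real.pi * Complex.I * (((-1 : ℤ) : ℂ) + (1 : ℝ) / 2) * -Complex.I =
          -2 * Real.pi := by
      push_cast
      linear_combination 2 * Real.pi * Complex.I_mul_I
    rw [hc] at h
    refine h.congr fun k => ?_
    rw [thetaDeriv_eq 1 1 (im_two_pow_mul_pos hτ k),
      mul_div_cancel_left₀ _ (leadingFactor_ne_zero _ _)]
  · have h1 : ‖(n : ℂ) + (1 : ℝ) / 2‖ ≤ 1 + |(n : ℝ)| := by
      refine (norm_add_le _ _).trans ?_
      rw [Complex.norm_intCast]
      norm_num
      linarith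
    rw [norm_mul]
    refine mul_le_mul (le_of_eq ?_) h1 (norm_nonneg _) (by positivity)
    simp [abs_of_pos Real.pi_pos]

/-- Jacobi's derivative formula. -/
theorem thetaDeriv_one_one {τ : ℂ} (hτ : 0 < τ.im) :
    thetaDeriv 1 1 τ = -Real.pi * (thetaConst 0 0 τ * thetaConst 1 0 τ * thetaConst 0 1 τ) := by
  have hconst (k : ℕ) : jacobiRatio (2 ^ k * τ) = jacobiRatio τ := by
    induction k with
    | zero => simp
    | succ k ih => rw [two_pow_succ_mul, jacobiRatio_two_mul (im_two_pow_mul_pos hτ k), ih]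
  -- The leading factors of `θ'[1;1]` and `θ[1;0]` cancel, leaving `-2π / (1 · 2 · 1)`.
  have h1 := (tendsto_thetaDeriv_one_one_div hτ).div
    (((tendsto_thetaConst_zero hτ 0).mul (tendsto_thetaConst_one_div hτ 0)).mul
      (tendsto_thetaConst_zero hτ 1)) (by simp)
  have h2 : jacobiRatio τ = -Real.pi := by
    refine tendsto_nhds_unique (tendsto_const_nhds.congr fun k => ?_)
      (h1.trans (le_of_eq ?_))
    · have hl := leadingFactor_ne_zero 1 (2 ^ k * τ)
      rw [← hconst k, jacobiRatio]
      simp only [Pi.div_apply]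
      field_simp
    · congr 1
      simp
      ring
  have h00 := thetaConst_ne_zero_of_abs_lt_one (ε := 0) (by simp) 0 hτ
  have h01 := thetaConst_zero_one_ne_zero hτ
  have h10 := thetaConst_one_zero_ne_zero hτ
  rw [← h2, jacobiRatio, div_mul_cancel₀]
  positivity

/-! ### Squares and doubled characteristics in terms of functions of `2s` at modulus `2τ`. -/

theorem thetaConst_zero_one_sq {τ : ℂ} (hτ : 0 < τ.im) :
    thetaConst 0 1 τ ^ 2 = thetaConst 0 0 (2 * τ) ^ 2 - thetaConst 1 0 (2 * τ) ^ 2 := by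
  have h := thetaConst_mul 0 1 0 1 hτ
  have h2 := thetaConst_add_two_right 0 0 (2 * τ)
  have h3 := thetaConst_add_two_right 1 0 (2 * τ)
  norm_num [phase_zero, phase_one] at h h2 h3
  rw [h2, h3] at h
  linear_combination h

/-- This and the next lemmas use the same pair `θ[δ;2δ']`, `θ[1+δ;2δ']` at `(2s, 2τ)`, which makes
elimination possible. -/
theorem thetaChar_one_sq (δ δ' : ℝ) (s : ℂ) {τ : ℂ} (hτ : 0 < τ.im) :
    thetaChar (1 + δ) (1 + δ') s τ ^ 2 =
      phase δ * (thetaChar δ (2 * δ') (2 * s) (2 * τ) * thetaConst 1 0 (2 * τ) -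
        thetaChar (1 + δ) (2 * δ') (2 * s) (2 * τ) * thetaConst 0 0 (2 * τ)) := by
  have h := thetaChar_mul (1 + δ) (1 + δ') (1 + δ) (1 + δ') s s hτ
  rw [show (1 + δ + (1 + δ)) / 2 = 1 + δ by ring, show 1 + δ' + (1 + δ') = 2 * δ' + 2 by ring,
    show (1 + δ - (1 + δ)) / 2 = 0 by ring, sub_self, sub_self, zero_add, ← two_mul,
    thetaChar_add_two_right, thetaChar_add_two_right, show 1 + δ + 1 = δ + 2 by ring,
    thetaChar_add_two_left, phase_add, phase_add, phase_one, phase_two] at h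
  rw [thetaConst, thetaConst]
  linear_combination h

theorem thetaChar_zero_one_sq (δ δ' : ℝ) (s : ℂ) {τ : ℂ} (hτ : 0 < τ.im) :
    thetaChar δ (1 + δ') s τ ^ 2 =
      phase δ * (thetaChar δ (2 * δ') (2 * s) (2 * τ) * thetaConst 0 0 (2 * τ) -
        thetaChar (1 + δ) (2 * δ') (2 * s) (2 * τ) * thetaConst 1 0 (2 * τ)) := by
  have h := thetaChar_mul δ (1 + δ') δ (1 + δ') s s hτ
  rw [show (δ + δ) / 2 = δ by ring, show 1 + δ' + (1 + δ') = 2 * δ' + 2 by ring,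
    show (δ - δ) / 2 = 0 by ring, sub_self, sub_self, zero_add, ← two_mul,
    thetaChar_add_two_right, thetaChar_add_two_right, add_comm δ 1, phase_add, phase_one] at h
  rw [thetaConst, thetaConst]
  linear_combination h

theorem thetaChar_one_zero_sq (δ' : ℝ) (s : ℂ) {τ : ℂ} (hτ : 0 < τ.im) :
    thetaChar 1 δ' s τ ^ 2 =
      thetaChar 0 (2 * δ') (2 * s) (2 * τ) * thetaConst 1 0 (2 * τ) +
        thetaChar 1 (2 * δ') (2 * s) (2 * τ) * thetaConst 0 0 (2 * τ) := by
  have h := thetaChar_mul 1 δ' 1 δ' s s hτ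
  rw [show ((1 : ℝ) + 1) / 2 = 1 by norm_num, ← two_mul, ← two_mul,
    show ((1 : ℝ) - 1) / 2 = 0 by norm_num, sub_self, sub_self, zero_add,
    show (1 : ℝ) + 1 = 0 + 2 by norm_num, thetaChar_add_two_left] at h
  rw [thetaConst, thetaConst]
  linear_combination h

theorem thetaChar_double_mul_zero_one (δ δ' : ℝ) (s : ℂ) {τ : ℂ} (hτ : 0 < τ.im) :
    thetaChar (2 * δ) (1 + 2 * δ') s τ * thetaChar 0 1 s τ =
      phase δ * (thetaChar δ (2 * δ') (2 * s) (2 * τ) * thetaConst δ (2 * δ') (2 * τ) -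
        thetaChar (1 + δ) (2 * δ') (2 * s) (2 * τ) * thetaConst (1 + δ) (2 * δ') (2 * τ)) := by
  have h := thetaChar_mul (2 * δ) (1 + 2 * δ') 0 1 s s hτ
  rw [show (2 * δ + 0) / 2 = δ by ring, show 1 + 2 * δ' + 1 = 2 * δ' + 2 by ring,
    show (2 * δ - 0) / 2 = δ by ring, add_sub_cancel_left, sub_self, ← two_mul,
    thetaChar_add_two_right, thetaChar_add_two_right, add_comm δ 1, phase_add, phase_one] at h
  rw [thetaConst, thetaConst]
  linear_combination h

theorem thetaChar_double_mul_one_one (δ δ' : ℝ) (s : ℂ) {τ : ℂ} (hτ : 0 < τ.im) :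
    thetaChar (1 + 2 * δ) (1 + 2 * δ') s τ * thetaChar 1 1 s τ =
      phase δ * (thetaChar δ (2 * δ') (2 * s) (2 * τ) * thetaConst (1 + δ) (2 * δ') (2 * τ) -
        thetaChar (1 + δ) (2 * δ') (2 * s) (2 * τ) * thetaConst δ (2 * δ') (2 * τ)) := by
  have h := thetaChar_mul (1 + 2 * δ) (1 + 2 * δ') 1 1 s s hτ
  rw [show (1 + 2 * δ + 1) / 2 = 1 + δ by ring, show 1 + 2 * δ' + 1 = 2 * δ' + 2 by ring,
    show (1 + 2 * δ - 1) / 2 = δ by ring, add_sub_cancel_left, sub_self, ← two_mul,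
    thetaChar_add_two_right, thetaChar_add_two_right, show 1 + δ + 1 = δ + 2 by ring,
    thetaChar_add_two_left, add_comm δ 1, phase_add, phase_add, phase_one, phase_two] at h
  rw [thetaConst, thetaConst]
  linear_combination h

theorem thetaChar_double_mul_one_zero (δ' : ℝ) (s : ℂ) {τ : ℂ} (hτ : 0 < τ.im) :
    thetaChar 1 (2 * δ') s τ * thetaChar 1 0 s τ =
      thetaChar 1 (2 * δ') (2 * s) (2 * τ) * thetaConst 0 (2 * δ') (2 * τ) +
        thetaChar 0 (2 * δ') (2 * s) (2 * τ) * thetaConst 1 (2 * δ') (2 * τ) := by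
  have h := thetaChar_mul 1 (2 * δ') 1 0 s s hτ
  rw [show ((1 : ℝ) + 1) / 2 = 1 by norm_num, ← two_mul, add_zero, sub_zero,
    show ((1 : ℝ) - 1) / 2 = 0 by norm_num, sub_self, zero_add,
    show (1 : ℝ) + 1 = 0 + 2 by norm_num, thetaChar_add_two_left] at h
  rw [thetaConst, thetaConst]
  linear_combination h

/-- The product with `θ[1;0]` gives two equal summands at `2τ`, hence the factor `2`. Multiplying by
`θ[0;0]θ[0;1] = θ[0;1](2τ)²` lets `thetaConst_mul_sub_one` bring each factor back to modulus `τ`. -/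
theorem thetaConst_duplication (δ δ' : ℝ) {τ : ℂ} (hτ : 0 < τ.im) :
    thetaConst (1 + 2 * δ) (1 + 2 * δ') τ *
        (thetaConst 1 0 τ * thetaConst 0 0 τ * thetaConst 0 1 τ) =
      2 * (thetaConst (1 + δ) (1 + δ') τ * thetaConst (1 + δ) δ' τ *
        (thetaConst δ δ' τ * thetaConst δ (1 + δ') τ)) := by
  have h1 := thetaConst_mul_sub_one (1 + δ) (1 + δ') hτ
  have h2 := thetaConst_mul_sub_one δ (1 + δ') hτ
  have h3 := thetaConst_zero_zero_mul_zero_one hτ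
  have h4 := thetaConst_mul (1 + 2 * δ) (1 + 2 * δ') 1 0 hτ
  rw [add_sub_cancel_left, show 2 * (1 + δ') - 1 = 1 + 2 * δ' by ring] at h1 h2
  rw [show (1 + 2 * δ + 1) / 2 = 1 + δ by ring, show (1 + 2 * δ - 1) / 2 = δ by ring, add_zero,
    sub_zero, show 1 + δ + 1 = δ + 2 by ring, thetaConst_add_two_left, add_comm δ 1] at h4
  calc _ = (thetaConst (1 + 2 * δ) (1 + 2 * δ') τ * thetaConst 1 0 τ) *
        (thetaConst 0 0 τ * thetaConst 0 1 τ) := by ring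
    _ = 2 * ((thetaConst (1 + δ) (1 + 2 * δ') (2 * τ) * thetaConst 0 1 (2 * τ)) *
        (thetaConst δ (1 + 2 * δ') (2 * τ) * thetaConst 0 1 (2 * τ))) := by
      rw [h3, h4]
      ring
    _ = _ := by
      rw [← h1, ← h2]
      ring

/-! ### Logarithmic derivatives from the three-term relations. -/

/-- Differentiation at the origin of the two three-term relations between a pair of functions
`a`, `d` whose duplications are multiples of `a (-s)` and `d (-s)`. -/
theorem log_deriv_of_duplication {a d t p : ℂ → ℂ} {a' d' p' t0 k l : ℂ}
    (ha : HasDerivAt a a' 0) (hd : HasDerivAt d d' 0) (ht : HasDerivAt t 0 0)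
    (hp : HasDerivAt p p' 0) (hp0 : p 0 = 0) (ht0 : t 0 = t0)
    (hk : ∀ s, k * d (-s) * t s * t0 ^ 2 = d s ^ 2 * d 0 ^ 2 - a s ^ 2 * a 0 ^ 2)
    (hl : ∀ s, l * a (-s) * p s * t0 ^ 2 = a s ^ 2 * d 0 ^ 2 - d s ^ 2 * a 0 ^ 2)
    (hk0 : k ≠ 0) (hka : a 0 ≠ 0) (hkd : d 0 ≠ 0) (hkt : t0 ≠ 0) :
    a' / a 0 = 1 / 3 * (l / k) * (p' * a 0 ^ 3 / (t0 * d 0 ^ 3)) +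
      l * p' * t0 ^ 2 / (2 * a 0 * d 0 ^ 2) := by
  have hneg : HasDerivAt (fun s : ℂ => -s) (-1) 0 := hasDerivAt_neg 0
  have hd' := hd.comp_of_eq (0 : ℂ) hneg neg_zero.symm
  have ha' := ha.comp_of_eq (0 : ℂ) hneg neg_zero.symm
  have e1 := (((hd'.const_mul k).mul ht).mul_const (t0 ^ 2)).unique
    ((((hd.pow 2).mul_const (d 0 ^ 2)).sub ((ha.pow 2).mul_const (a 0 ^ 2))).congr_of_eventuallyEq
      (Filter.Eventually.of_forall hk))
  have e2 := (((ha'.const_mul l).mul hp).mul_const (t0 ^ 2)).unique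
    ((((ha.pow 2).mul_const (d 0 ^ 2)).sub ((hd.pow 2).mul_const (a 0 ^ 2))).congr_of_eventuallyEq
      (Filter.Eventually.of_forall hl))
  have e0 := hk 0
  simp only [Function.comp_apply, neg_zero, hp0, ht0, mul_zero, add_zero, zero_add] at e0 e1 e2
  norm_num at e1 e2
  have f2 : 2 * d 0 * (a' * d 0 - a 0 * d') = l * p' * t0 ^ 2 := by
    refine mul_left_cancel₀ hka ?_
    linear_combination -e2
  -- The relation at `0` replaces `d 0 ^ 4 - a 0 ^ 4`, and `f2` removes `a'`. The `3`, source of the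
  -- final `1/3`, is `2` from the derivative of `d²` plus `1` from that of `d (-s)`.
  have f1 : 3 * d' * k * t0 * d 0 ^ 2 = a 0 ^ 3 * l * p' := by
    refine mul_left_cancel₀ (pow_ne_zero 2 hkt) ?_
    linear_combination 2 * d 0 * d' * e0 - d 0 ^ 2 * e1 + a 0 ^ 3 * f2
  field_simp
  linear_combination 3 * k * t0 * d 0 * f2 + 2 * a 0 * f1

theorem hasDerivAt_zero_of_even {f : ℂ → ℂ} (hf : DifferentiableAt ℂ f 0)
    (heven : ∀ s, f (-s) = f s) : HasDerivAt f 0 0 := by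
  have h := hf.hasDerivAt
  have h1 := h.comp_of_eq (0 : ℂ) (hasDerivAt_neg 0) neg_zero.symm
  rw [show f ∘ Neg.neg = f from funext heven] at h1
  have h2 := h1.unique h
  have h3 : deriv f 0 = 0 := by linear_combination (-1 / 2 : ℂ) * h2
  rwa [h3] at h

theorem thetaChar_zero_one_neg (s τ : ℂ) : thetaChar 0 1 (-s) τ = thetaChar 0 1 s τ := by
  have h := thetaChar_neg 0 1 (-s) τ
  have h1 := thetaChar_add_two_right 0 (-1) s τ
  norm_num [phase_zero] at h h1
  rw [← h, h1]

theorem thetaChar_one_zero_neg (s τ : ℂ) : thetaChar 1 0 (-s) τ = thetaChar 1 0 s τ := by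
  have h := thetaChar_neg 1 0 (-s) τ
  have h1 := thetaChar_add_two_left (-1) 0 s τ
  norm_num at h h1
  rw [← h, h1]

/-- The logarithmic derivative of a theta function at a characteristic whose double is, up to a
constant, its negative. -/
theorem logDeriv_thetaConst {δ δ' : ℝ} {k l τ : ℂ} (hτ : 0 < τ.im) (hk0 : k ≠ 0)
    (hk : ∀ s, thetaChar (2 * δ) (1 + 2 * δ') s τ = k * thetaChar δ (1 + δ') (-s) τ)
    (hl : ∀ s, thetaChar (1 + 2 * δ) (1 + 2 * δ') s τ = l * thetaChar (1 + δ) (1 + δ') (-s) τ)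
    (ha : thetaConst (1 + δ) (1 + δ') τ ≠ 0) (hd : thetaConst δ (1 + δ') τ ≠ 0) :
    thetaDeriv (1 + δ) (1 + δ') τ / thetaConst (1 + δ) (1 + δ') τ =
      1 / 3 * (l / k) * (thetaDeriv 1 1 τ * thetaConst (1 + δ) (1 + δ') τ ^ 3 /
          (thetaConst 0 1 τ * thetaConst δ (1 + δ') τ ^ 3)) +
        phase δ * (thetaDeriv 1 1 τ * thetaConst 0 1 τ * thetaConst (1 + δ) δ' τ *
          thetaConst δ δ' τ / (thetaConst 0 0 τ * thetaConst 1 0 τ *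
            thetaConst (1 + δ) (1 + δ') τ * thetaConst δ (1 + δ') τ)) := by
  have h00 := thetaConst_ne_zero_of_abs_lt_one (ε := 0) (by simp) 0 hτ
  have h01 := thetaConst_zero_one_ne_zero hτ
  have h10 := thetaConst_one_zero_ne_zero hτ
  have hδ := phase_ne_zero δ
  have ht := thetaConst_zero_one_sq hτ
  have h := log_deriv_of_duplication (k := phase δ * k) (l := phase δ * l)
    (hasDerivAt_thetaChar_zero (1 + δ) (1 + δ') hτ) (hasDerivAt_thetaChar_zero δ (1 + δ') hτ)
    (hasDerivAt_zero_of_even (differentiableAt_thetaChar 0 1 0 hτ)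
      fun s => thetaChar_zero_one_neg s τ)
    (hasDerivAt_thetaChar_zero 1 1 hτ) (thetaConst_one_one τ) (rfl : _ = thetaConst 0 1 τ)
    (fun s => ?_) (fun s => ?_) (mul_ne_zero hδ hk0) ha hd h01
  · have hdup := thetaConst_duplication δ δ' hτ
    have hl0 : thetaConst (1 + 2 * δ) (1 + 2 * δ') τ = l * thetaConst (1 + δ) (1 + δ') τ := by
      simpa [thetaConst] using hl 0
    rw [hl0] at hdup
    -- The duplication formula evaluates `l`, replacing it by the four theta constants of the second
    -- summand.
    have hdup' : l * (thetaConst 1 0 τ * thetaConst 0 0 τ * thetaConst 0 1 τ) =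
        2 * (thetaConst (1 + δ) δ' τ * (thetaConst δ δ' τ * thetaConst δ (1 + δ') τ)) := by
      refine mul_left_cancel₀ ha ?_
      linear_combination hdup
    refine h.trans ?_
    rw [mul_div_mul_left _ _ hδ]
    change _ + phase δ * l * thetaDeriv 1 1 τ * thetaConst 0 1 τ ^ 2 /
      (2 * thetaConst (1 + δ) (1 + δ') τ * thetaConst δ (1 + δ') τ ^ 2) = _
    congr 1
    field_simp
    linear_combination thetaDeriv 1 1 τ * hdup'
  -- In `d(s)² d(0)² - a(s)² a(0)²` the mixed terms cancel and `θ[0;0](2τ)² - θ[1;0](2τ)² =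
  -- θ[0;1](τ)²` factors out.
  · have e1 := thetaChar_double_mul_zero_one δ δ' s hτ
    have e2 := thetaChar_zero_one_sq δ δ' s hτ
    have e3 := thetaChar_one_sq δ δ' s hτ
    have e4 := thetaChar_zero_one_sq δ δ' 0 hτ
    have e5 := thetaChar_one_sq δ δ' 0 hτ
    rw [hk] at e1
    rw [mul_zero] at e4 e5
    rw [e2, e3, e4, e5, ht]
    simp only [thetaConst] at *
    linear_combination (phase δ * (thetaChar 0 0 0 (2 * τ) ^ 2 - thetaChar 1 0 0 (2 * τ) ^ 2)) * e1
  · have e1 := thetaChar_double_mul_one_one δ δ' s hτ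
    have e2 := thetaChar_zero_one_sq δ δ' s hτ
    have e3 := thetaChar_one_sq δ δ' s hτ
    have e4 := thetaChar_zero_one_sq δ δ' 0 hτ
    have e5 := thetaChar_one_sq δ δ' 0 hτ
    rw [hl] at e1
    rw [mul_zero] at e4 e5
    rw [e2, e3, e4, e5, ht]
    simp only [thetaConst] at *
    linear_combination (phase δ * (thetaChar 0 0 0 (2 * τ) ^ 2 - thetaChar 1 0 0 (2 * τ) ^ 2)) * e1

/-- The analogue of `logDeriv_thetaConst` for a real half-period, with the roles of the two even
theta functions `θ[0; 1]` and `θ[1; 0]` interchanged. -/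
theorem logDeriv_thetaConst_one {δ' : ℝ} {k l τ : ℂ} (hτ : 0 < τ.im) (hk0 : k ≠ 0)
    (hk : ∀ s, thetaChar 1 (2 * δ') s τ = k * thetaChar 1 δ' (-s) τ)
    (hl : ∀ s, thetaChar 1 (1 + 2 * δ') s τ = l * thetaChar 1 (1 + δ') (-s) τ)
    (ha : thetaConst 1 (1 + δ') τ ≠ 0) (hd : thetaConst 1 δ' τ ≠ 0) :
    thetaDeriv 1 (1 + δ') τ / thetaConst 1 (1 + δ') τ =
      1 / 3 * (l / k) * (thetaDeriv 1 1 τ * thetaConst 1 (1 + δ') τ ^ 3 /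
          (thetaConst 1 0 τ * thetaConst 1 δ' τ ^ 3)) +
        thetaDeriv 1 1 τ * thetaConst 1 0 τ * thetaConst 0 (1 + δ') τ *
          thetaConst 0 δ' τ / (thetaConst 0 0 τ * thetaConst 0 1 τ *
            thetaConst 1 (1 + δ') τ * thetaConst 1 δ' τ) := by
  have h00 := thetaConst_ne_zero_of_abs_lt_one (ε := 0) (by simp) 0 hτ
  have h01 := thetaConst_zero_one_ne_zero hτ
  have h10 := thetaConst_one_zero_ne_zero hτ
  have ht := thetaConst_one_zero_sq hτ
  have hsq (s : ℂ) := thetaChar_one_sq 0 δ' s hτ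
  have h := log_deriv_of_duplication (k := k) (l := l)
    (hasDerivAt_thetaChar_zero 1 (1 + δ') hτ) (hasDerivAt_thetaChar_zero 1 δ' hτ)
    (hasDerivAt_zero_of_even (differentiableAt_thetaChar 1 0 0 hτ)
      fun s => thetaChar_one_zero_neg s τ)
    (hasDerivAt_thetaChar_zero 1 1 hτ) (thetaConst_one_one τ) (rfl : _ = thetaConst 1 0 τ)
    (fun s => ?_) (fun s => ?_) hk0 ha hd h10
  · have hdup := thetaConst_duplication 0 δ' hτ
    have hl0 : thetaConst 1 (1 + 2 * δ') τ = l * thetaConst 1 (1 + δ') τ := by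
      simpa [thetaConst] using hl 0
    rw [mul_zero, add_zero, hl0] at hdup
    have hdup' : l * (thetaConst 1 0 τ * thetaConst 0 0 τ * thetaConst 0 1 τ) =
        2 * (thetaConst 1 δ' τ * (thetaConst 0 δ' τ * thetaConst 0 (1 + δ') τ)) := by
      refine mul_left_cancel₀ ha ?_
      linear_combination hdup
    refine h.trans ?_
    change _ + l * thetaDeriv 1 1 τ * thetaConst 1 0 τ ^ 2 /
      (2 * thetaConst 1 (1 + δ') τ * thetaConst 1 δ' τ ^ 2) = _
    congr 1
    field_simp
    linear_combination thetaDeriv 1 1 τ * hdup'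
  -- Here the squares differ only in the sign of one term, so the mixed terms survive with factor `2
  -- θ[0;0](2τ) θ[1;0](2τ) = θ[1;0](τ)²`.
  · have e1 := thetaChar_double_mul_one_zero δ' s hτ
    have e2 := thetaChar_one_zero_sq δ' s hτ
    have e3 := hsq s
    have e4 := thetaChar_one_zero_sq δ' 0 hτ
    have e5 := hsq 0
    rw [hk] at e1
    rw [mul_zero] at e4 e5
    rw [add_zero, phase_zero, one_mul] at e3 e5
    rw [e2, e3, e4, e5, ht]
    simp only [thetaConst] at *
    linear_combination (2 * (thetaChar 0 0 0 (2 * τ) * thetaChar 1 0 0 (2 * τ))) * e1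
  · have e1 := thetaChar_double_mul_one_one 0 δ' s hτ
    have e2 := thetaChar_one_zero_sq δ' s hτ
    have e3 := hsq s
    have e4 := thetaChar_one_zero_sq δ' 0 hτ
    have e5 := hsq 0
    rw [mul_zero, add_zero, hl, phase_zero, one_mul] at e1
    rw [mul_zero] at e4 e5
    rw [add_zero, phase_zero, one_mul] at e3 e5
    rw [e2, e3, e4, e5, ht]
    simp only [thetaConst] at *
    linear_combination (2 * (thetaChar 0 0 0 (2 * τ) * thetaChar 1 0 0 (2 * τ))) * e1

/-! ### Specialization to characteristics with denominator three. -/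

theorem zetaRoot_three : zetaRoot 3 = phase (2 / 3) := by
  rw [zetaRoot, phase]
  congr 1
  push_cast
  ring

theorem zetaRoot_three_ne_zero : zetaRoot 3 ≠ 0 := Complex.exp_ne_zero _

theorem phase_four_thirds : phase (4 / 3) = zetaRoot 3 ^ 2 := by
  rw [zetaRoot_three, sq, ← phase_add]
  norm_num

theorem zetaRoot_three_pow : zetaRoot 3 ^ 3 = 1 := by
  rw [pow_succ, ← phase_four_thirds, zetaRoot_three, ← phase_add, ← phase_two]
  norm_num

theorem phase_neg_two_thirds : phase (-2 / 3) = zetaRoot 3 ^ 2 := by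
  rw [← phase_four_thirds, show (4 / 3 : ℝ) = -2 / 3 + 2 by norm_num, phase_add, phase_two, mul_one]

theorem phase_one_third : phase (1 / 3) = -zetaRoot 3 ^ 2 := by
  rw [← phase_neg_two_thirds, show (1 / 3 : ℝ) = -2 / 3 + 1 by norm_num, phase_add, phase_one]
  ring

theorem phase_neg_one_third : phase (-1 / 3) = -zetaRoot 3 := by
  rw [zetaRoot_three, show (2 / 3 : ℝ) = -1 / 3 + 1 by norm_num, phase_add, phase_one]
  ring

/-- Parity combined with shifts by even integers; it supplies the multipliers `k` and `l` when
doubling agrees with negation modulo `2`. -/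
theorem thetaChar_eq_phase_mul_neg {ε ε' σ σ' : ℝ} (i j : ℤ) (h : ε = -σ + 2 * i)
    (h' : ε' = -σ' + 2 * j) (s τ : ℂ) :
    thetaChar ε ε' s τ = phase (-(j * σ)) * thetaChar σ σ' (-s) τ := by
  rw [← thetaChar_neg σ σ' (-s) τ, neg_neg, h, h', thetaChar_eq_tsum, thetaChar_eq_tsum,
    ← (Equiv.subRight i).tsum_eq, ← tsum_mul_left]
  refine tsum_congr fun n => ?_
  rw [thetaTerm, thetaTerm, phase, ← Complex.exp_add, Complex.exp_eq_exp_iff_exists_int]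
  refine ⟨n * j, ?_⟩
  simp only [Equiv.subRight_apply]
  push_cast
  ring

theorem thetaConst_eq_phase_mul {ε ε' σ σ' : ℝ} (i j : ℤ) (h : ε = -σ + 2 * i)
    (h' : ε' = -σ' + 2 * j) (τ : ℂ) :
    thetaConst ε ε' τ = phase (-(j * σ)) * thetaConst σ σ' τ := by
  simpa [thetaConst] using thetaChar_eq_phase_mul_neg i j h h' 0 τ

theorem logDeriv_one_third_one_third {τ : ℂ} (hτ : 0 < τ.im) :
    thetaDeriv (1 / 3) (1 / 3) τ / thetaConst (1 / 3) (1 / 3) τ =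
      1 / 3 * (thetaDeriv 1 1 τ * thetaConst (1 / 3) (1 / 3) τ ^ 3 /
          (thetaConst 0 1 τ * thetaConst (2 / 3) (5 / 3) τ ^ 3)) -
        zetaRoot 3 * (thetaDeriv 1 1 τ * thetaConst 0 1 τ *
            thetaConst (1 / 3) (4 / 3) τ * thetaConst (2 / 3) (2 / 3) τ /
          (thetaConst 0 0 τ * thetaConst 1 0 τ *
            thetaConst (1 / 3) (1 / 3) τ * thetaConst (2 / 3) (5 / 3) τ)) := by
  have hne {ε : ℝ} (hε : |ε| < 1) (ε' : ℝ) := thetaConst_ne_zero_of_abs_lt_one hε ε' hτ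
  have hz := zetaRoot_three_ne_zero
  have hz3 := zetaRoot_three_pow
  -- `δ = δ' = -2/3` makes `1 + δ = 1 + δ' = 1/3`, with doubles `≡ -δ` and `≡ -1/3` modulo `2`. Here
  -- `k = l = 1`.
  have h := logDeriv_thetaConst (δ := -2 / 3) (δ' := -2 / 3) hτ (phase_ne_zero _)
    (thetaChar_eq_phase_mul_neg (-1) 0 (by norm_num) (by norm_num) · τ)
    (thetaChar_eq_phase_mul_neg 0 0 (by norm_num) (by norm_num) · τ)
    (hne (by rw [abs_lt]; norm_num) _) (hne (by rw [abs_lt]; norm_num) _)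
  have hd := thetaConst_eq_phase_mul (ε := -2 / 3) (ε' := 1 / 3) (σ := 2 / 3) (σ' := 5 / 3) 0 1
    (by norm_num) (by norm_num) τ
  have hc := thetaConst_eq_phase_mul (ε := -2 / 3) (ε' := -2 / 3) (σ := 2 / 3) (σ' := 2 / 3) 0 0
    (by norm_num) (by norm_num) τ
  have hb := thetaConst_add_two_right (1 / 3) (-2 / 3) τ
  rw [show (-2 / 3 : ℝ) + 2 = 4 / 3 by norm_num, phase_one_third] at hb
  rw [show -(((1 : ℤ) : ℝ) * (2 / 3)) = -2 / 3 by norm_num, phase_neg_two_thirds] at hd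
  rw [Int.cast_zero, zero_mul, neg_zero, phase_zero, one_mul] at hc
  rw [Int.cast_zero, zero_mul, zero_mul, neg_zero, phase_zero, phase_neg_two_thirds,
    show (1 : ℝ) + -2 / 3 = 1 / 3 by norm_num, hd, hc] at h
  rw [h, hb, mul_pow, show (zetaRoot 3 ^ 2) ^ 3 = 1 by rw [← pow_mul, mul_comm, pow_mul, hz3,
    one_pow]]
  field_simp
  rw [hz3]
  ring

theorem logDeriv_one_third_one {τ : ℂ} (hτ : 0 < τ.im) :
    thetaDeriv (1 / 3) 1 τ / thetaConst (1 / 3) 1 τ =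
      -(1 / 3) * (thetaDeriv 1 1 τ * thetaConst (1 / 3) 1 τ ^ 3 /
          (thetaConst 0 1 τ * thetaConst (2 / 3) 1 τ ^ 3)) +
        thetaDeriv 1 1 τ * thetaConst 0 1 τ *
            thetaConst (1 / 3) 0 τ * thetaConst (2 / 3) 0 τ /
          (thetaConst 0 0 τ * thetaConst 1 0 τ *
            thetaConst (1 / 3) 1 τ * thetaConst (2 / 3) 1 τ) := by
  have hne {ε : ℝ} (hε : |ε| < 1) (ε' : ℝ) := thetaConst_ne_zero_of_abs_lt_one hε ε' hτ
  have hz := zetaRoot_three_ne_zero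
  have hz3 := zetaRoot_three_pow
  -- Now `k = ζ₃` and `l = -ζ₃`, so `l / k = -1` gives the minus sign before `1/3`.
  have h := logDeriv_thetaConst (δ := -2 / 3) (δ' := 0) hτ (phase_ne_zero _)
    (thetaChar_eq_phase_mul_neg (-1) 1 (by norm_num) (by norm_num) · τ)
    (thetaChar_eq_phase_mul_neg 0 1 (by norm_num) (by norm_num) · τ)
    (hne (by rw [abs_lt]; norm_num) _) (hne (by rw [abs_lt]; norm_num) _)
  have hd := thetaConst_eq_phase_mul (ε := -2 / 3) (ε' := 1) (σ := 2 / 3) (σ' := 1) 0 1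
    (by norm_num) (by norm_num) τ
  have hc := thetaConst_eq_phase_mul (ε := -2 / 3) (ε' := 0) (σ := 2 / 3) (σ' := 0) 0 0
    (by norm_num) (by norm_num) τ
  rw [show -(((1 : ℤ) : ℝ) * (2 / 3)) = -2 / 3 by norm_num, phase_neg_two_thirds] at hd
  rw [Int.cast_zero, zero_mul, neg_zero, phase_zero, one_mul] at hc
  rw [show -(((1 : ℤ) : ℝ) * (1 + -2 / 3)) = -1 / 3 by norm_num,
    show -(((1 : ℤ) : ℝ) * (-2 / 3)) = 2 / 3 by norm_num, phase_neg_one_third, ← zetaRoot_three,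
    neg_div_self hz, phase_neg_two_thirds, add_zero,
    show (1 : ℝ) + -2 / 3 = 1 / 3 by norm_num, hd, hc, mul_pow,
    show (zetaRoot 3 ^ 2) ^ 3 = 1 by rw [← pow_mul, mul_comm, pow_mul, hz3, one_pow]] at h
  rw [h]
  field_simp

theorem logDeriv_one_third_five_thirds {τ : ℂ} (hτ : 0 < τ.im) :
    thetaDeriv (1 / 3) (5 / 3) τ / thetaConst (1 / 3) (5 / 3) τ =
      1 / 3 * (thetaDeriv 1 1 τ * thetaConst (1 / 3) (5 / 3) τ ^ 3 /
          (thetaConst 0 1 τ * thetaConst (2 / 3) (1 / 3) τ ^ 3)) +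
        zetaRoot 3 ^ 2 * (thetaDeriv 1 1 τ * thetaConst 0 1 τ *
            thetaConst (1 / 3) (2 / 3) τ * thetaConst (2 / 3) (4 / 3) τ /
          (thetaConst 0 0 τ * thetaConst 1 0 τ *
            thetaConst (1 / 3) (5 / 3) τ * thetaConst (2 / 3) (1 / 3) τ)) := by
  have hne {ε : ℝ} (hε : |ε| < 1) (ε' : ℝ) := thetaConst_ne_zero_of_abs_lt_one hε ε' hτ
  have hz := zetaRoot_three_ne_zero
  have hz3 := zetaRoot_three_pow
  have h := logDeriv_thetaConst (δ := -2 / 3) (δ' := 2 / 3) hτ (phase_ne_zero _)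
    (thetaChar_eq_phase_mul_neg (-1) 2 (by norm_num) (by norm_num) · τ)
    (thetaChar_eq_phase_mul_neg 0 2 (by norm_num) (by norm_num) · τ)
    (hne (by rw [abs_lt]; norm_num) _) (hne (by rw [abs_lt]; norm_num) _)
  have hd := thetaConst_eq_phase_mul (ε := -2 / 3) (ε' := 5 / 3) (σ := 2 / 3) (σ' := 1 / 3) 0 1
    (by norm_num) (by norm_num) τ
  have hc := thetaConst_eq_phase_mul (ε := -2 / 3) (ε' := 2 / 3) (σ := 2 / 3) (σ' := 4 / 3) 0 1
    (by norm_num) (by norm_num) τ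
  rw [show -(((1 : ℤ) : ℝ) * (2 / 3)) = -2 / 3 by norm_num, phase_neg_two_thirds] at hc hd
  rw [show -(((2 : ℤ) : ℝ) * (1 + -2 / 3)) = -2 / 3 by norm_num,
    show -(((2 : ℤ) : ℝ) * (-2 / 3)) = 4 / 3 by norm_num, phase_neg_two_thirds, phase_four_thirds,
    div_self (pow_ne_zero 2 hz), show (1 : ℝ) + 2 / 3 = 5 / 3 by norm_num,
    show (1 : ℝ) + -2 / 3 = 1 / 3 by norm_num, hd, hc, mul_pow,
    show (zetaRoot 3 ^ 2) ^ 3 = 1 by rw [← pow_mul, mul_comm, pow_mul, hz3, one_pow]] at h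
  rw [h]
  field_simp

theorem logDeriv_one_one_third {τ : ℂ} (hτ : 0 < τ.im) :
    thetaDeriv 1 (1 / 3) τ / thetaConst 1 (1 / 3) τ =
      -(1 / 3) * (thetaDeriv 1 1 τ * thetaConst 1 (1 / 3) τ ^ 3 /
          (thetaConst 1 0 τ * thetaConst 1 (2 / 3) τ ^ 3)) +
        thetaDeriv 1 1 τ * thetaConst 1 0 τ *
            thetaConst 0 (1 / 3) τ * thetaConst 0 (2 / 3) τ /
          (thetaConst 0 0 τ * thetaConst 0 1 τ *
            thetaConst 1 (1 / 3) τ * thetaConst 1 (2 / 3) τ) := by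
  have hd : thetaConst 1 (-2 / 3) τ = thetaConst 1 (2 / 3) τ := by
    rw [neg_div, thetaConst_one_neg]
  have hc : thetaConst 0 (-2 / 3) τ = thetaConst 0 (2 / 3) τ := by
    simpa [neg_div] using thetaConst_neg 0 (2 / 3) τ
  have h13 : (1 : ℝ) + -2 / 3 = 1 / 3 := by norm_num
  -- Here `k = phase 1 = -1` and `l = 1`.
  have h := logDeriv_thetaConst_one (δ' := -2 / 3) hτ (phase_ne_zero _)
    (thetaChar_eq_phase_mul_neg 1 (-1) (by norm_num) (by norm_num) · τ)
    (thetaChar_eq_phase_mul_neg 1 0 (by norm_num) (by norm_num) · τ)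
    (by rw [h13]; exact thetaConst_one_third_ne_zero hτ)
    (by rw [hd]; exact thetaConst_one_two_thirds_ne_zero hτ)
  rw [h13, hd, hc, Int.cast_zero, zero_mul, neg_zero, phase_zero, Int.cast_neg, Int.cast_one,
    neg_mul, one_mul, neg_neg, phase_one] at h
  rw [h]
  ring

theorem mainTheorem9 (τ : ℂ) (hτ : 0 < τ.im) :
    (thetaConst 0 0 τ ≠ 0 ∧
      thetaConst 1 0 τ ≠ 0 ∧
      thetaConst 0 1 τ ≠ 0 ∧
      thetaConst (1/3) (1/3) τ ≠ 0 ∧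
      thetaConst (2/3) (5/3) τ ≠ 0 ∧
      thetaConst (1/3) 1 τ ≠ 0 ∧
      thetaConst (2/3) 1 τ ≠ 0 ∧
      thetaConst (1/3) (5/3) τ ≠ 0 ∧
      thetaConst (2/3) (1/3) τ ≠ 0 ∧
      thetaConst 1 (1/3) τ ≠ 0 ∧
      thetaConst 1 (2/3) τ ≠ 0) ∧
    (thetaDeriv (1/3) (1/3) τ / thetaConst (1/3) (1/3) τ =
        (1 / 3) * (thetaDeriv 1 1 τ * thetaConst (1/3) (1/3) τ ^ 3 /
            (thetaConst 0 1 τ * thetaConst (2/3) (5/3) τ ^ 3))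
        - zetaRoot 3 * (thetaDeriv 1 1 τ * thetaConst 0 1 τ *
              thetaConst (1/3) (4/3) τ * thetaConst (2/3) (2/3) τ /
            (thetaConst 0 0 τ * thetaConst 1 0 τ *
              thetaConst (1/3) (1/3) τ * thetaConst (2/3) (5/3) τ))
      ∧
      (1 / 3) * (thetaDeriv 1 1 τ * thetaConst (1/3) (1/3) τ ^ 3 /
            (thetaConst 0 1 τ * thetaConst (2/3) (5/3) τ ^ 3))
        - zetaRoot 3 * (thetaDeriv 1 1 τ * thetaConst 0 1 τ *
              thetaConst (1/3) (4/3) τ * thetaConst (2/3) (2/3) τ /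
            (thetaConst 0 0 τ * thetaConst 1 0 τ *
              thetaConst (1/3) (1/3) τ * thetaConst (2/3) (5/3) τ))
        =
        -((Real.pi : ℂ) / 3) * thetaConst 0 0 τ * thetaConst 1 0 τ *
          (thetaConst (1/3) (1/3) τ ^ 3 / thetaConst (2/3) (5/3) τ ^ 3)
        + (Real.pi : ℂ) * zetaRoot 3 * thetaConst 0 1 τ ^ 2 *
          (thetaConst (1/3) (4/3) τ * thetaConst (2/3) (2/3) τ /
            (thetaConst (1/3) (1/3) τ * thetaConst (2/3) (5/3) τ))) ∧
    (thetaDeriv (1/3) 1 τ / thetaConst (1/3) 1 τ =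
        -(1 / 3) * (thetaDeriv 1 1 τ * thetaConst (1/3) 1 τ ^ 3 /
            (thetaConst 0 1 τ * thetaConst (2/3) 1 τ ^ 3))
        + (thetaDeriv 1 1 τ * thetaConst 0 1 τ *
              thetaConst (1/3) 0 τ * thetaConst (2/3) 0 τ /
            (thetaConst 0 0 τ * thetaConst 1 0 τ *
              thetaConst (1/3) 1 τ * thetaConst (2/3) 1 τ))
      ∧
      -(1 / 3) * (thetaDeriv 1 1 τ * thetaConst (1/3) 1 τ ^ 3 /
            (thetaConst 0 1 τ * thetaConst (2/3) 1 τ ^ 3))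
        + (thetaDeriv 1 1 τ * thetaConst 0 1 τ *
              thetaConst (1/3) 0 τ * thetaConst (2/3) 0 τ /
            (thetaConst 0 0 τ * thetaConst 1 0 τ *
              thetaConst (1/3) 1 τ * thetaConst (2/3) 1 τ))
        =
        ((Real.pi : ℂ) / 3) * thetaConst 0 0 τ * thetaConst 1 0 τ *
          (thetaConst (1/3) 1 τ ^ 3 / thetaConst (2/3) 1 τ ^ 3)
        - (Real.pi : ℂ) * thetaConst 0 1 τ ^ 2 *
          (thetaConst (1/3) 0 τ * thetaConst (2/3) 0 τ /
            (thetaConst (1/3) 1 τ * thetaConst (2/3) 1 τ))) ∧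
    (thetaDeriv (1/3) (5/3) τ / thetaConst (1/3) (5/3) τ =
        (1 / 3) * (thetaDeriv 1 1 τ * thetaConst (1/3) (5/3) τ ^ 3 /
            (thetaConst 0 1 τ * thetaConst (2/3) (1/3) τ ^ 3))
        + zetaRoot 3 ^ 2 * (thetaDeriv 1 1 τ * thetaConst 0 1 τ *
              thetaConst (1/3) (2/3) τ * thetaConst (2/3) (4/3) τ /
            (thetaConst 0 0 τ * thetaConst 1 0 τ *
              thetaConst (1/3) (5/3) τ * thetaConst (2/3) (1/3) τ))
      ∧
      (1 / 3) * (thetaDeriv 1 1 τ * thetaConst (1/3) (5/3) τ ^ 3 /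
            (thetaConst 0 1 τ * thetaConst (2/3) (1/3) τ ^ 3))
        + zetaRoot 3 ^ 2 * (thetaDeriv 1 1 τ * thetaConst 0 1 τ *
              thetaConst (1/3) (2/3) τ * thetaConst (2/3) (4/3) τ /
            (thetaConst 0 0 τ * thetaConst 1 0 τ *
              thetaConst (1/3) (5/3) τ * thetaConst (2/3) (1/3) τ))
        =
        -((Real.pi : ℂ) / 3) * thetaConst 0 0 τ * thetaConst 1 0 τ *
          (thetaConst (1/3) (5/3) τ ^ 3 / thetaConst (2/3) (1/3) τ ^ 3)
        - (Real.pi : ℂ) * zetaRoot 3 ^ 2 * thetaConst 0 1 τ ^ 2 *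
          (thetaConst (1/3) (2/3) τ * thetaConst (2/3) (4/3) τ /
            (thetaConst (1/3) (5/3) τ * thetaConst (2/3) (1/3) τ))) ∧
    (thetaDeriv 1 (1/3) τ / thetaConst 1 (1/3) τ =
        -(1 / 3) * (thetaDeriv 1 1 τ * thetaConst 1 (1/3) τ ^ 3 /
            (thetaConst 1 0 τ * thetaConst 1 (2/3) τ ^ 3))
        + (thetaDeriv 1 1 τ * thetaConst 1 0 τ *
              thetaConst 0 (1/3) τ * thetaConst 0 (2/3) τ /
            (thetaConst 0 0 τ * thetaConst 0 1 τ *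
              thetaConst 1 (1/3) τ * thetaConst 1 (2/3) τ))
      ∧
      -(1 / 3) * (thetaDeriv 1 1 τ * thetaConst 1 (1/3) τ ^ 3 /
            (thetaConst 1 0 τ * thetaConst 1 (2/3) τ ^ 3))
        + (thetaDeriv 1 1 τ * thetaConst 1 0 τ *
              thetaConst 0 (1/3) τ * thetaConst 0 (2/3) τ /
            (thetaConst 0 0 τ * thetaConst 0 1 τ *
              thetaConst 1 (1/3) τ * thetaConst 1 (2/3) τ))
        =
        ((Real.pi : ℂ) / 3) * thetaConst 0 0 τ * thetaConst 0 1 τ *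
          (thetaConst 1 (1/3) τ ^ 3 / thetaConst 1 (2/3) τ ^ 3)
        - (Real.pi : ℂ) * thetaConst 1 0 τ ^ 2 *
          (thetaConst 0 (1/3) τ * thetaConst 0 (2/3) τ /
            (thetaConst 1 (1/3) τ * thetaConst 1 (2/3) τ))) := by
  have h00 := thetaConst_ne_zero_of_abs_lt_one (ε := 0) (by simp) 0 hτ
  have h01 := thetaConst_zero_one_ne_zero hτ
  have h10 := thetaConst_one_zero_ne_zero hτ
  have h1 := thetaConst_ne_zero_of_abs_lt_one (ε := 1 / 3) (by rw [abs_lt]; norm_num) (τ := τ)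
  have h2 := thetaConst_ne_zero_of_abs_lt_one (ε := 2 / 3) (by rw [abs_lt]; norm_num) (τ := τ)
  have h3 := thetaConst_one_third_ne_zero hτ
  have h4 := thetaConst_one_two_thirds_ne_zero hτ
  -- Substituting Jacobi's formula turns each first expression into the second by field arithmetic.
  have hJ := thetaDeriv_one_one hτ
  refine ⟨⟨h00, h10, h01, h1 _ hτ, h2 _ hτ, h1 _ hτ, h2 _ hτ, h1 _ hτ, h2 _ hτ, h3, h4⟩,
    ⟨logDeriv_one_third_one_third hτ, ?_⟩, ⟨logDeriv_one_third_one hτ, ?_⟩,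
    ⟨logDeriv_one_third_five_thirds hτ, ?_⟩, ⟨logDeriv_one_one_third hτ, ?_⟩⟩
  · have ha := h1 (1 / 3) hτ
    have hd := h2 (5 / 3) hτ
    rw [hJ]
    field_simp
    ring
  · have ha := h1 1 hτ
    have hd := h2 1 hτ
    rw [hJ]
    field_simp
    ring
  · have ha := h1 (5 / 3) hτ
    have hd := h2 (1 / 3) hτ
    rw [hJ]
    field_simp
    ring
  · rw [hJ]
    field_simp
    ring
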